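/- Let $k,n,p,r$ be nonnegative integers with $p<r<k$ and $r\le n$. Let $\Sigma$ be a real symmetric positive semidefinite $k\times k$ matrix with $\operatorname{rank}\Sigma=r$, let $\mu\in\mathbb R^k$ and $\kappa>0$, and let $M$ be a (deterministic) real $p\times k$ matrix of rank $p$. Let $A\sim\mathcal W_k(n,\Sigma)$, that is, $A$ has the distribution of $\sum_{i=1}^n x_ix_i^T$ with $x_1,\dots,x_n$ independent and $\mathcal N_k(0,\Sigma)$-distributed; let $z\sim\mathcal N_k(\mu,\kappa\Sigma)$ (a singular normal distribution), and let $A$ and $z$ be independent. For a positive semidefinite matrix $D$ let $D^{1/2}$ be its positive semidefinite square root and let $D^{-1/2}$ be the inverse of $D^{1/2}$ if $D$ is nonsingular and the Moore–Penrose inverse of $D^{1/2}$ otherwise. Put $$P=(M\Sigma M^T)^{-1/2}M\Sigma^{1/2},\qquad Q=P^TP,\qquad c(t)=\frac{\sqrt{t^Tt}-\sqrt{t^T(I_k-Q)t}}{t^TQt}\quad(t\in\mathbb R^k),$$ where $c(t):=0$ if $t^TQt=0$ (in that case $Pt=0$, so that this value is immaterial below). Let $\zeta\sim\chi^2_n$,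 $t\sim\mathcal N_k(\Sigma^{1/2}\mu,\kappa\Sigma^2)$ and $z_0\sim\mathcal N_p(0,I_p)$ be mutually independent random variables, defined on any probability space. Then $MAz$ is equal in distribution to $$\zeta\,M\Sigma^{1/2}t+\sqrt{\zeta}\,(M\Sigma M^T)^{1/2}\left[\sqrt{t^Tt}\,I_p-c(t)\,P\,t\,t^TP^T\right]z_0 .$$ -/

import Mathlib

open MeasureTheory ProbabilityTheory Matrix
open scoped MatrixOrder

/-- The product (equivalently, Borel) σ-algebra on the space of matrices, entry by entry. -/
instance matrixMeasurableSpace (m n : Type*) : MeasurableSpace (Matrix m n ℝ) :=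
  inferInstanceAs (MeasurableSpace (m → n → ℝ))

/-- The Wishart law `W_k(n, S)`: the law of `X Xᵀ = ∑ i, x_i x_iᵀ`, where the `n` columns `x_i` of
the `k × n` matrix `X` are independent with law `N_k(0, S)`. The positive semidefinite matrix `S`
may be singular, and `n` may be smaller or larger than `k`. -/
noncomputable def wishart {k : ℕ} (n : ℕ) (S : Matrix (Fin k) (Fin k) ℝ) :
    Measure (Matrix (Fin k) (Fin k) ℝ) :=
  (Measure.pi fun _ : Fin n => multivariateGaussian (0 : EuclideanSpace ℝ (Fin k)) S).map
    fun x => ∑ i, vecMulVec (x i).ofLp (x i).ofLp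

/-- The chi-squared law with `n` degrees of freedom: the law of the sum of the squares of `n`
independent standard normal variables. -/
noncomputable def chiSquared (n : ℕ) : Measure ℝ :=
  (Measure.pi fun _ : Fin n => gaussianReal 0 1).map fun x => ∑ i, x i ^ 2

/-- `D^{-1/2}` for a positive semidefinite matrix `D`, through the functional calculus. It is the
inverse of the positive semidefinite square root `CFC.sqrt D` when `D` is nonsingular
(`invSqrt_eq_inv`). The eigenvalue `0` is sent to `0`, so that for a singular `D` it is the
Moore-Penrose inverse of `CFC.sqrt D` (`invSqrt_isHermitian`, `sqrt_mul_invSqrt_comm`,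
`sqrt_mul_invSqrt_mul_sqrt`, `invSqrt_mul_sqrt_mul_invSqrt`). -/
noncomputable def invSqrt {p : ℕ} (D : Matrix (Fin p) (Fin p) ℝ) : Matrix (Fin p) (Fin p) ℝ :=
  D ^ (-(1 / 2) : ℝ)

theorem invSqrt_eq_inv {p : ℕ} {D : Matrix (Fin p) (Fin p) ℝ} (hD : D.PosDef) :
    invSqrt D = (CFC.sqrt D)⁻¹ := by
  have h : D ^ (-(1 / 2) : ℝ) * D ^ (1 / 2 : ℝ) = 1 :=
    CFC.rpow_neg_mul_rpow (1 / 2) hD.isStrictlyPositive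
  rw [invSqrt, CFC.sqrt_eq_rpow]
  exact (Matrix.inv_eq_left_inv h).symm

theorem continuousOn_spectrum_nnreal {p : ℕ} (D : Matrix (Fin p) (Fin p) ℝ) (f : NNReal → NNReal) :
    ContinuousOn f (spectrum NNReal D) := by
  have h : (spectrum NNReal D).Finite := by
    have h2 := (Matrix.finite_real_spectrum (A := D))
    refine Set.Finite.of_finite_image (f := ((↑) : NNReal → ℝ)) (h2.subset ?_)
      NNReal.coe_injective.injOn
    rintro _ ⟨x, hx, rfl⟩
    exact (spectrum.algebraMap_mem_iff (S := ℝ) (R := NNReal) (a := D)).2 hx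
  exact h.continuousOn f

theorem invSqrt_isHermitian {p : ℕ} (D : Matrix (Fin p) (Fin p) ℝ) : (invSqrt D).IsHermitian :=
  (Matrix.nonneg_iff_posSemidef.1 CFC.rpow_nonneg).isHermitian

theorem sqrt_mul_invSqrt_comm {p : ℕ} (D : Matrix (Fin p) (Fin p) ℝ) :
    CFC.sqrt D * invSqrt D = invSqrt D * CFC.sqrt D := by
  rw [invSqrt, CFC.sqrt_eq_rpow, CFC.rpow_def, CFC.rpow_def]
  exact cfc_commute_cfc _ _ D

theorem sqrt_mul_invSqrt_mul_sqrt {p : ℕ} (D : Matrix (Fin p) (Fin p) ℝ) :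
    CFC.sqrt D * invSqrt D * CFC.sqrt D = CFC.sqrt D := by
  rw [invSqrt, CFC.sqrt_eq_rpow, CFC.rpow_def, CFC.rpow_def,
    ← cfc_mul _ _ D (continuousOn_spectrum_nnreal D _) (continuousOn_spectrum_nnreal D _),
    ← cfc_mul _ _ D (continuousOn_spectrum_nnreal D _) (continuousOn_spectrum_nnreal D _)]
  congr 1
  funext x
  rcases eq_or_ne x 0 with rfl | hx
  · norm_num
  · rw [NNReal.rpow_neg, mul_inv_cancel₀ (by simp [hx]), one_mul]

theorem invSqrt_mul_sqrt_mul_invSqrt {p : ℕ} (D : Matrix (Fin p) (Fin p) ℝ) :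
    invSqrt D * CFC.sqrt D * invSqrt D = invSqrt D := by
  rw [invSqrt, CFC.sqrt_eq_rpow, CFC.rpow_def, CFC.rpow_def,
    ← cfc_mul _ _ D (continuousOn_spectrum_nnreal D _) (continuousOn_spectrum_nnreal D _),
    ← cfc_mul _ _ D (continuousOn_spectrum_nnreal D _) (continuousOn_spectrum_nnreal D _)]
  congr 1
  funext x
  rcases eq_or_ne x 0 with rfl | hx
  · norm_num
  · rw [NNReal.rpow_neg, inv_mul_cancel₀ (by simp [hx]), one_mul]

/-- The scalar `c(t) = (√(tᵀt) - √(tᵀ(I - Q)t)) / (tᵀQt)`. It is only used with `Q = Pᵀ P` and as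
the coefficient of `P t tᵀ Pᵀ`, which vanishes whenever `tᵀQt = 0`, so that the value of the
quotient there is immaterial. -/
noncomputable def reprCoeff {k : ℕ} (Q : Matrix (Fin k) (Fin k) ℝ) (t : Fin k → ℝ) : ℝ :=
  (√(t ⬝ᵥ t) - √(t ⬝ᵥ ((1 - Q) *ᵥ t))) / (t ⬝ᵥ (Q *ᵥ t))

/-! Both laws have the same characteristic function. Take a functional `v`, put `N = M * CFC.sqrt
S`, `s = Nᵀ v`, and condition on `z`, with `t = S^{1/2} z`. Then `vᵀ M A z` is a sum of `n`
independent copies of `⟨g, s⟩⟨g, t⟩`, `g` standard Gaussian. Splitting `⟨g, s⟩` into a multiple of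
`⟨g, t⟩` and an independent part, and integrating out the latter, gives `E exp(ζ (i β - (α γ - β²) /
2))` with `ζ ~ χ²_n`, `α = tᵀt`, `β = sᵀt`, `γ = sᵀs` (`integral_exp_dotProduct_mulVec_wishart`). On
the other side, given `t` and `ζ`, the functional is Gaussian with mean `ζ β`, and `c(t)` is chosen
to make its variance `ζ (α γ - β²)` (`dotProduct_self_sub_reprCoeff`, `integral_exp_repr`). As
`S^{1/2} z` has the law of `t` (`multivariateGaussian_map_sqrt`), integrating over `z` finishes. -/

/-! ### Products of two Gaussian functionals -/

theorem integral_exp_inner_mul_inner_stdGaussian {E : Type*} [NormedAddCommGroup E]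
    [InnerProductSpace ℝ E] [FiniteDimensional ℝ E] [MeasurableSpace E] [BorelSpace E] (s t : E) :
    ∫ g, Complex.exp (((inner ℝ g s * inner ℝ g t : ℝ) : ℂ) * Complex.I) ∂stdGaussian E =
      ∫ u, Complex.exp ((u ^ 2 : ℝ) * ((inner ℝ s t : ℝ) * Complex.I -
        ((inner ℝ t t * inner ℝ s s - inner ℝ s t ^ 2 : ℝ) : ℂ) / 2)) ∂gaussianReal 0 1 := by
  set α : ℝ := inner ℝ t t with hα
  set β : ℝ := inner ℝ s t with hβ
  set γ : ℝ := inner ℝ s s with hγ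
  have hα0 : 0 ≤ α := real_inner_self_nonneg
  -- If `α = 0` then `t = 0`, so `β = 0`, and the conventions `x / 0 = 0` keep the identities below
  -- valid.
  have hz : α = 0 → β = 0 := fun h => by
    rw [hβ, inner_self_eq_zero.1 h, inner_zero_right]
  have hcs : β ^ 2 ≤ α * γ := by
    have := real_inner_mul_inner_self_le s t
    nlinarith
  have hδ : 0 ≤ γ - β ^ 2 / α := by
    rcases hα0.eq_or_lt with h | h
    · rw [← h, div_zero, sub_zero]; exact real_inner_self_nonneg
    · rw [sub_nonneg, div_le_iff₀ h]; linarith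
  have hβα : √α * (β / √α) = β := by
    by_cases h : α = 0
    · simp [h, hz h]
    · have : √α ≠ 0 := (Real.sqrt_pos.2 (hα0.lt_of_ne' h)).ne'
      field_simp
  have hαδ : α * (γ - β ^ 2 / α) = α * γ - β ^ 2 := by
    by_cases h : α = 0
    · simp [h, hz h]
    · field_simp
  have hβ2 : (β / √α) ^ 2 = β ^ 2 / α := by rw [div_pow, Real.sq_sqrt hα0]
  let f : E → ℝ × ℝ := fun g => (inner ℝ g t, inner ℝ g s)
  -- The Cholesky factor of the Gram matrix of `(t, s)`: two independent normals reproduce the joint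
  -- law.
  let h : ℝ × ℝ → ℝ × ℝ := fun x =>
    (√α * x.1, (β / √α) * x.1 + √(γ - β ^ 2 / α) * x.2)
  have hf : Measurable f := by fun_prop
  have hh : Measurable h := by fun_prop
  have key : (stdGaussian E).map f = ((gaussianReal 0 1).prod (gaussianReal 0 1)).map h := by
    have := Measure.isProbabilityMeasure_map (μ := stdGaussian E) hf.aemeasurable
    have := Measure.isProbabilityMeasure_map
      (μ := (gaussianReal 0 1).prod (gaussianReal 0 1)) hh.aemeasurable
    refine Measure.ext_of_charFunDual ?_
    ext L
    have hL : ∀ x : ℝ × ℝ, L x = L (1, 0) * x.1 + L (0, 1) * x.2 := fun x => by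
      conv_lhs => rw [show x = x.1 • ((1 : ℝ), (0 : ℝ)) + x.2 • ((0 : ℝ), (1 : ℝ)) by simp]
      rw [map_add, map_smul, map_smul, smul_eq_mul, smul_eq_mul]; ring
    set a := L (1, 0)
    set b := L (0, 1)
    rw [charFunDual_apply, charFunDual_apply,
      integral_map hf.aemeasurable (Measurable.aestronglyMeasurable (by fun_prop)),
      integral_map hh.aemeasurable (Measurable.aestronglyMeasurable (by fun_prop))]
    have h1 : ∀ g, ((L (f g) : ℝ) : ℂ) = ((inner ℝ g (a • t + b • s) : ℝ) : ℂ) := fun g => by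
      rw [hL, inner_add_right, inner_smul_right, inner_smul_right]
    have h2 : ∀ x : ℝ × ℝ, Complex.exp ((L (h x) : ℝ) * Complex.I) =
        Complex.exp ((a * √α + b * (β / √α) : ℝ) * x.1 * Complex.I) *
        Complex.exp ((b * √(γ - β ^ 2 / α) : ℝ) * x.2 * Complex.I) := fun x => by
      rw [← Complex.exp_add, hL]
      congr 1
      simp only [h]
      push_cast
      ring
    simp_rw [h1, h2]
    rw [← charFun_apply, charFun_stdGaussian,
      integral_prod_mul (fun x : ℝ => Complex.exp ((a * √α + b * (β / √α) : ℝ) * x * Complex.I))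
        (fun x : ℝ => Complex.exp ((b * √(γ - β ^ 2 / α) : ℝ) * x * Complex.I)),
      ← charFun_apply_real, ← charFun_apply_real, charFun_gaussianReal, charFun_gaussianReal,
      ← Complex.exp_add]
    congr 1
    rw [← Complex.ofReal_pow, ← real_inner_self_eq_norm_sq, inner_add_left, inner_add_right,
      inner_add_right]
    simp only [inner_smul_left, inner_smul_right, real_inner_comm s t, ← hα, ← hβ, ← hγ]
    have h3 : (a * √α + b * (β / √α)) ^ 2 + (b * √(γ - β ^ 2 / α)) ^ 2 =
        a ^ 2 * α + 2 * a * b * β + b ^ 2 * γ := by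
      have e1 := Real.sq_sqrt hα0
      have e2 := Real.sq_sqrt hδ
      linear_combination a ^ 2 * e1 + b ^ 2 * e2 + b ^ 2 * hβ2 + 2 * a * b * hβα
    have h4 := congrArg (fun x : ℝ => (x : ℂ)) h3
    push_cast at h4 ⊢
    simp only [conj_trivial]
    linear_combination (1 / 2) * h4
  have e1 : ∫ g, Complex.exp (((inner ℝ g s * inner ℝ g t : ℝ) : ℂ) * Complex.I) ∂stdGaussian E =
      ∫ x : ℝ × ℝ, Complex.exp (((x.2 * x.1 : ℝ) : ℂ) * Complex.I) ∂(stdGaussian E).map f := by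
    rw [integral_map hf.aemeasurable (Measurable.aestronglyMeasurable (by fun_prop))]
  rw [e1, key, integral_map hh.aemeasurable (Measurable.aestronglyMeasurable (by fun_prop)),
    integral_prod]
  -- For fixed `u` the exponent is affine in `v`, so the inner integral is a Gaussian characteristic
  -- function.
  · refine integral_congr_ae (.of_forall fun u => ?_)
    have h2 : ∀ v : ℝ, Complex.exp ((((h (u, v)).2 * (h (u, v)).1 : ℝ) : ℂ) * Complex.I) =
        Complex.exp (((u ^ 2 * β : ℝ) : ℂ) * Complex.I) *
        Complex.exp ((u * √α * √(γ - β ^ 2 / α) : ℝ) * v * Complex.I) := fun v => by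
      rw [← Complex.exp_add]
      congr 1
      have : (h (u, v)).2 * (h (u, v)).1 = u ^ 2 * β + u * √α * √(γ - β ^ 2 / α) * v := by
        simp only [h]
        linear_combination u ^ 2 * hβα
      rw [this]
      push_cast
      ring
    simp only [h2]
    rw [integral_const_mul, ← charFun_apply_real, charFun_gaussianReal, ← Complex.exp_add]
    congr 1
    have h3 : (u * √α * √(γ - β ^ 2 / α)) ^ 2 = u ^ 2 * (α * γ - β ^ 2) := by
      rw [mul_pow, mul_pow, Real.sq_sqrt hα0, Real.sq_sqrt hδ, mul_assoc, hαδ]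
    rw [← Complex.ofReal_pow, h3]
    push_cast
    ring
  · refine Integrable.of_bound (C := 1) (Measurable.aestronglyMeasurable (by fun_prop))
      (.of_forall fun x => ?_)
    rw [Complex.norm_exp_ofReal_mul_I]

/-- The second variable comes first so that Fubini later conditions on `t`. -/
theorem hasLaw_prodMk_of_iIndep {Ω α β γ : Type*} [MeasurableSpace Ω] {P : Measure Ω}
    [IsProbabilityMeasure P] {mα : MeasurableSpace α} {mβ : MeasurableSpace β}
    {mγ : MeasurableSpace γ}
    {X : Ω → α} {Y : Ω → β} {Z : Ω → γ} {μ : Measure α} {ν : Measure β} {ρ : Measure γ}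
    [IsProbabilityMeasure μ] [IsProbabilityMeasure ν] [IsProbabilityMeasure ρ]
    (hX : HasLaw X μ P) (hY : HasLaw Y ν P) (hZ : HasLaw Z ρ P)
    (h : iIndep ![mα.comap X, mβ.comap Y, mγ.comap Z] P) :
    HasLaw (fun ω => (Y ω, X ω, Z ω)) (ν.prod (μ.prod ρ)) P where
  aemeasurable := hY.aemeasurable.prodMk (hX.aemeasurable.prodMk hZ.aemeasurable)
  map_eq := by
    have hm := hY.aemeasurable.prodMk (hX.aemeasurable.prodMk hZ.aemeasurable)
    have := Measure.isProbabilityMeasure_map hm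
    refine Measure.ext_prod₃ fun {s t u} hs ht hu => ?_
    rw [Measure.map_apply_of_aemeasurable hm (hs.prod (ht.prod hu)), Measure.prod_prod,
      Measure.prod_prod, ← hX.map_eq, ← hY.map_eq, ← hZ.map_eq,
      Measure.map_apply_of_aemeasurable hX.aemeasurable ht,
      Measure.map_apply_of_aemeasurable hY.aemeasurable hs,
      Measure.map_apply_of_aemeasurable hZ.aemeasurable hu]
    have h1 := h.meas_iInter (s := ![X ⁻¹' t, Y ⁻¹' s, Z ⁻¹' u]) (fun i => by
      fin_cases i
      exacts [⟨t, ht, rfl⟩, ⟨s, hs, rfl⟩, ⟨u, hu, rfl⟩])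
    simp only [Fin.prod_univ_three, Matrix.cons_val_zero, Matrix.cons_val_one,
      Matrix.cons_val_two] at h1
    have h2 : (fun ω => (Y ω, X ω, Z ω)) ⁻¹' (s ×ˢ t ×ˢ u) =
        ⋂ i, ![X ⁻¹' t, Y ⁻¹' s, Z ⁻¹' u] i := by
      ext ω
      simp [Fin.forall_fin_succ]
      tauto
    rw [h2, h1]
    simp
    ring

/-! ### Algebra of `P` and of the coefficient `c(t)` -/

/-- Since `B N Nᵀ = 0` forces `B N = 0`, the Moore-Penrose relation for `N Nᵀ` passes to `N`, also
when `N Nᵀ` is singular. -/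
theorem sqrt_mul_invSqrt_mul_eq {k p : ℕ} (N : Matrix (Fin p) (Fin k) ℝ) :
    CFC.sqrt (N * Nᵀ) * (invSqrt (N * Nᵀ) * N) = N := by
  have hD : (N * Nᵀ).PosSemidef := by
    simpa using Matrix.posSemidef_self_mul_conjTranspose N
  have h1 : (CFC.sqrt (N * Nᵀ) * invSqrt (N * Nᵀ) - 1) * (N * Nᴴ) = 0 := by
    rw [conjTranspose_eq_transpose_of_trivial]
    nth_rewrite 3 [← CFC.sqrt_mul_sqrt_self (N * Nᵀ) hD.nonneg]
    rw [sub_mul, one_mul, ← mul_assoc, sqrt_mul_invSqrt_mul_sqrt, sub_self]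
  rw [Matrix.mul_self_mul_conjTranspose_eq_zero, Matrix.sub_mul, Matrix.one_mul, sub_eq_zero] at h1
  rw [← Matrix.mul_assoc, h1]

/-- This makes `P` a partial isometry, hence `Q = Pᵀ P` an orthogonal projection. -/
theorem invSqrt_mul_mul_transpose_mul_self {k p : ℕ} (N : Matrix (Fin p) (Fin k) ℝ) :
    (invSqrt (N * Nᵀ) * N) * (invSqrt (N * Nᵀ) * N)ᵀ * (invSqrt (N * Nᵀ) * N) =
      invSqrt (N * Nᵀ) * N := by
  have hD : (N * Nᵀ).PosSemidef := by
    simpa using Matrix.posSemidef_self_mul_conjTranspose N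
  have hs := CFC.sqrt_mul_sqrt_self (N * Nᵀ) hD.nonneg
  have hE : (invSqrt (N * Nᵀ))ᵀ = invSqrt (N * Nᵀ) := by
    simpa using (invSqrt_isHermitian (N * Nᵀ)).eq
  have hc := sqrt_mul_invSqrt_comm (N * Nᵀ)
  have hi := invSqrt_mul_sqrt_mul_invSqrt (N * Nᵀ)
  have hN := sqrt_mul_invSqrt_mul_eq N
  rw [transpose_mul, hE]
  generalize invSqrt (N * Nᵀ) = E at *
  calc E * N * (Nᵀ * E) * (E * N) = E * (N * Nᵀ) * E * (E * N) := by simp only [Matrix.mul_assoc]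
    _ = E * CFC.sqrt (N * Nᵀ) * (CFC.sqrt (N * Nᵀ) * E) * (E * N) := by
      conv_lhs => rw [← hs]
      simp only [Matrix.mul_assoc]
    _ = E * CFC.sqrt (N * Nᵀ) * E * (CFC.sqrt (N * Nᵀ) * (E * N)) := by
      rw [hc]; simp only [Matrix.mul_assoc]
    _ = E * N := by rw [hi, hN]

/-- With `q = |P t|²`, the coefficient is a root of `q c² - 2 √(tᵀt) c + 1`. The projection property
gives `tᵀ(1 - Q)t = tᵀt - q ≥ 0`, so the discriminant has a real square root. -/
theorem reprCoeff_identity {k p : ℕ} (P : Matrix (Fin p) (Fin k) ℝ) (hP : P * Pᵀ * P = P)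
    (t : Fin k → ℝ) (h : P *ᵥ t ≠ 0) :
    2 * √(t ⬝ᵥ t) * reprCoeff (Pᵀ * P) t - reprCoeff (Pᵀ * P) t ^ 2 * (P *ᵥ t ⬝ᵥ P *ᵥ t) = 1 := by
  have hq : t ⬝ᵥ (Pᵀ * P) *ᵥ t = P *ᵥ t ⬝ᵥ P *ᵥ t := by
    rw [← mulVec_mulVec, dotProduct_mulVec, vecMul_transpose]
  have hq0 : P *ᵥ t ⬝ᵥ P *ᵥ t ≠ 0 := by simpa using h
  have hid : (1 - Pᵀ * P)ᵀ * (1 - Pᵀ * P) = 1 - Pᵀ * P := by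
    have : Pᵀ * P * (Pᵀ * P) = Pᵀ * P := by rw [Matrix.mul_assoc, ← Matrix.mul_assoc P, hP]
    simp [mul_sub, sub_mul, this]
  have hs0 : 0 ≤ t ⬝ᵥ (1 - Pᵀ * P) *ᵥ t := by
    rw [← hid, ← mulVec_mulVec, dotProduct_mulVec, vecMul_transpose]
    simpa using dotProduct_star_self_nonneg ((1 - Pᵀ * P) *ᵥ t)
  have hs : t ⬝ᵥ (1 - Pᵀ * P) *ᵥ t = t ⬝ᵥ t - P *ᵥ t ⬝ᵥ P *ᵥ t := by
    rw [sub_mulVec, one_mulVec, dotProduct_sub, hq]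
  have e1 := Real.sq_sqrt (show 0 ≤ t ⬝ᵥ t by simpa using dotProduct_star_self_nonneg t)
  have e2 := Real.sq_sqrt hs0
  rw [reprCoeff, hq]
  rw [hs] at e2 ⊢
  generalize P *ᵥ t ⬝ᵥ P *ᵥ t = q at *
  field_simp
  linear_combination e1 - e2

theorem transpose_sqrt {k : ℕ} (S : Matrix (Fin k) (Fin k) ℝ) : (CFC.sqrt S)ᵀ = CFC.sqrt S := by
  simpa using (Matrix.nonneg_iff_posSemidef.1 (CFC.sqrt_nonneg S)).isHermitian.eq

theorem dotProduct_sqrt_mulVec {k : ℕ} (S : Matrix (Fin k) (Fin k) ℝ) (x y : Fin k → ℝ) :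
    x ⬝ᵥ CFC.sqrt S *ᵥ y = CFC.sqrt S *ᵥ x ⬝ᵥ y := by
  rw [dotProduct_mulVec, ← mulVec_transpose, transpose_sqrt]

theorem inner_eq_dotProduct {k : ℕ} (x y : EuclideanSpace ℝ (Fin k)) :
    inner ℝ x y = x.ofLp ⬝ᵥ y.ofLp := by
  rw [EuclideanSpace.inner_eq_star_dotProduct, star_trivial, dotProduct_comm]

/-! ### Integrability and measurability -/

theorem integrable_exp_ofReal_mul_I {α : Type*} [MeasurableSpace α] {ν : Measure α}
    [IsFiniteMeasure ν] {f : α → ℝ} (hf : Measurable f) :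
    Integrable (fun x => Complex.exp ((f x : ℂ) * Complex.I)) ν :=
  Integrable.of_bound (C := 1) (Measurable.aestronglyMeasurable (by fun_prop))
    (.of_forall fun x => (Complex.norm_exp_ofReal_mul_I _).le)

@[fun_prop]
theorem Measurable.const_mulVec {α m n : Type*} [MeasurableSpace α] [Fintype n]
    (B : Matrix m n ℝ) {f : α → n → ℝ} (hf : Measurable f) :
    Measurable fun x => B *ᵥ f x :=
  measurable_pi_iff.2 fun i => by
    simp only [mulVec, dotProduct]
    fun_prop

@[fun_prop]
theorem Measurable.dotProduct {α n : Type*} [MeasurableSpace α] [Fintype n]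
    {f g : α → n → ℝ} (hf : Measurable f) (hg : Measurable g) :
    Measurable fun x => f x ⬝ᵥ g x := by
  simp only [_root_.dotProduct]
  fun_prop

@[fun_prop]
theorem Measurable.matrix_mulVec {α m n : Type*} [MeasurableSpace α] [Fintype n]
    {A : α → Matrix m n ℝ} {f : α → n → ℝ} (hA : Measurable A) (hf : Measurable f) :
    Measurable fun x => A x *ᵥ f x :=
  measurable_pi_iff.2 fun i => by
    have : ∀ j, Measurable fun x => A x i j := fun j =>
      (measurable_pi_apply j).comp ((measurable_pi_apply i).comp hA)
    simp only [mulVec, _root_.dotProduct]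
    fun_prop

@[fun_prop]
theorem measurable_reprCoeff {k : ℕ} (Q : Matrix (Fin k) (Fin k) ℝ) :
    Measurable (reprCoeff Q) := by
  unfold reprCoeff
  fun_prop

theorem measurable_sum_vecMulVec (n k : ℕ) :
    Measurable fun x : Fin n → EuclideanSpace ℝ (Fin k) =>
      ∑ i, vecMulVec (x i).ofLp (x i).ofLp :=
  measurable_pi_iff.2 fun a => measurable_pi_iff.2 fun b => by
    simp only [Matrix.sum_apply, vecMulVec_apply]
    fun_prop

instance isProbabilityMeasure_wishart {k : ℕ} (n : ℕ) (S : Matrix (Fin k) (Fin k) ℝ) :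
    IsProbabilityMeasure (wishart n S) :=
  Measure.isProbabilityMeasure_map (measurable_sum_vecMulVec n k).aemeasurable

instance isProbabilityMeasure_chiSquared (n : ℕ) : IsProbabilityMeasure (chiSquared n) :=
  Measure.isProbabilityMeasure_map (Measurable.aemeasurable (by fun_prop))

/-! ### Chi-squared, Wishart and singular normal laws -/

theorem ae_nonneg_chiSquared (n : ℕ) : ∀ᵐ x ∂chiSquared n, 0 ≤ x := by
  rw [chiSquared, ae_map_iff (Measurable.aemeasurable (by fun_prop)) measurableSet_Ici]
  exact .of_forall fun x => Finset.sum_nonneg fun i _ => sq_nonneg _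

theorem integral_exp_mul_chiSquared (n : ℕ) (c : ℂ) :
    ∫ x, Complex.exp (x * c) ∂chiSquared n =
      (∫ u, Complex.exp ((u ^ 2 : ℝ) * c) ∂gaussianReal 0 1) ^ n := by
  rw [chiSquared, integral_map (Measurable.aemeasurable (by fun_prop))
    (Measurable.aestronglyMeasurable (by fun_prop))]
  simp_rw [Complex.ofReal_sum, Finset.sum_mul, Complex.exp_sum]
  rw [integral_fintype_prod_eq_pow (fun u : ℝ => Complex.exp ((u ^ 2 : ℝ) * c)), Fintype.card_fin]

theorem integral_exp_dotProduct_stdGaussian {p : ℕ} (b : Fin p → ℝ) :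
    ∫ g : EuclideanSpace ℝ (Fin p), Complex.exp (((g.ofLp ⬝ᵥ b : ℝ) : ℂ) * Complex.I)
      ∂stdGaussian (EuclideanSpace ℝ (Fin p)) = Complex.exp (-((b ⬝ᵥ b : ℝ) : ℂ) / 2) := by
  have h := charFun_stdGaussian (WithLp.toLp 2 b)
  rw [charFun_apply, ← Complex.ofReal_pow, ← real_inner_self_eq_norm_sq] at h
  simpa only [inner_eq_dotProduct] using h

/-- The characteristic function of a linear functional `A ↦ sᵀ A z` of a Wishart matrix. -/
theorem integral_exp_dotProduct_mulVec_wishart {k : ℕ} (n : ℕ) (S : Matrix (Fin k) (Fin k) ℝ)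
    (s z : Fin k → ℝ) :
    ∫ A, Complex.exp (((s ⬝ᵥ A *ᵥ z : ℝ) : ℂ) * Complex.I) ∂wishart n S =
      ∫ x, Complex.exp (x * (((CFC.sqrt S *ᵥ s ⬝ᵥ CFC.sqrt S *ᵥ z : ℝ) : ℂ) * Complex.I -
        (((CFC.sqrt S *ᵥ z ⬝ᵥ CFC.sqrt S *ᵥ z) * (CFC.sqrt S *ᵥ s ⬝ᵥ CFC.sqrt S *ᵥ s) -
          (CFC.sqrt S *ᵥ s ⬝ᵥ CFC.sqrt S *ᵥ z) ^ 2 : ℝ) : ℂ) / 2)) ∂chiSquared n := by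
  have hs : ∀ x : Fin n → EuclideanSpace ℝ (Fin k),
      s ⬝ᵥ (∑ i, vecMulVec (x i).ofLp (x i).ofLp) *ᵥ z =
        ∑ i, ((x i).ofLp ⬝ᵥ s) * ((x i).ofLp ⬝ᵥ z) := fun x => by
    rw [Matrix.sum_mulVec, dotProduct_sum]
    refine Finset.sum_congr rfl fun i _ => ?_
    rw [vecMulVec_mulVec, op_smul_eq_smul, dotProduct_smul, smul_eq_mul, dotProduct_comm s, mul_comm]
  rw [integral_exp_mul_chiSquared, wishart,
    integral_map (measurable_sum_vecMulVec n k).aemeasurable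
      (Measurable.aestronglyMeasurable (by fun_prop))]
  simp_rw [hs, Complex.ofReal_sum, Finset.sum_mul, Complex.exp_sum]
  rw [integral_fintype_prod_eq_pow (fun x : EuclideanSpace ℝ (Fin k) =>
    Complex.exp (((x.ofLp ⬝ᵥ s * (x.ofLp ⬝ᵥ z) : ℝ) : ℂ) * Complex.I)), Fintype.card_fin]
  congr 1
  rw [multivariateGaussian, integral_map (Measurable.aemeasurable (by fun_prop))
    (Measurable.aestronglyMeasurable (by fun_prop))]
  have h := integral_exp_inner_mul_inner_stdGaussian
    (WithLp.toLp 2 (CFC.sqrt S *ᵥ s)) (WithLp.toLp 2 (CFC.sqrt S *ᵥ z))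
  have h2 : ∀ (g : EuclideanSpace ℝ (Fin k)) (y : Fin k → ℝ),
      (0 + toEuclideanCLM (𝕜 := ℝ) (CFC.sqrt S) g).ofLp ⬝ᵥ y =
        inner ℝ g (WithLp.toLp 2 (CFC.sqrt S *ᵥ y)) := fun g y => by
    rw [zero_add, inner_eq_dotProduct, dotProduct_sqrt_mulVec, ofLp_toEuclideanCLM]
  simp_rw [h2]
  rw [h]
  simp only [inner_eq_dotProduct]

/-- The square root is symmetric, so it moves across the inner product in the characteristic
function; the covariance becomes `S^{1/2} (κ S) S^{1/2} = κ S²`. -/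
theorem multivariateGaussian_map_sqrt {k : ℕ} {S : Matrix (Fin k) (Fin k) ℝ} (hS : S.PosSemidef)
    (μ : EuclideanSpace ℝ (Fin k)) {κ : ℝ} (hκ : 0 ≤ κ) :
    (multivariateGaussian μ (κ • S)).map (fun z => WithLp.toLp 2 (CFC.sqrt S *ᵥ z.ofLp)) =
      multivariateGaussian (WithLp.toLp 2 (CFC.sqrt S *ᵥ μ.ofLp)) (κ • S ^ 2) := by
  have hm : Measurable fun z : EuclideanSpace ℝ (Fin k) =>
      (WithLp.toLp 2 (CFC.sqrt S *ᵥ z.ofLp) : EuclideanSpace ℝ (Fin k)) := by fun_prop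
  have := Measure.isProbabilityMeasure_map (μ := multivariateGaussian μ (κ • S)) hm.aemeasurable
  have hi : ∀ x y : EuclideanSpace ℝ (Fin k),
      inner ℝ (WithLp.toLp 2 (CFC.sqrt S *ᵥ x.ofLp) : EuclideanSpace ℝ (Fin k)) y =
        inner ℝ x (WithLp.toLp 2 (CFC.sqrt S *ᵥ y.ofLp)) := fun x y => by
    rw [inner_eq_dotProduct, inner_eq_dotProduct, dotProduct_sqrt_mulVec]
  refine Measure.ext_of_charFun ?_
  ext x
  rw [charFun_apply, integral_map hm.aemeasurable (Measurable.aestronglyMeasurable (by fun_prop))]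
  simp_rw [hi]
  rw [← charFun_apply, charFun_multivariateGaussian (hS.smul hκ),
    charFun_multivariateGaussian ((hS.pow 2).smul hκ), real_inner_comm,
    real_inner_comm _ x, hi]
  congr 3
  have hR := CFC.sqrt_mul_sqrt_self S hS.nonneg
  have : CFC.sqrt S * (κ • S) * CFC.sqrt S = κ • S ^ 2 := by
    nth_rewrite 2 [← hR]
    nth_rewrite 5 [← hR]
    simp [pow_two, Matrix.mul_assoc]
  rw [← this, ← mulVec_mulVec, ← mulVec_mulVec, dotProduct_sqrt_mulVec]

/-! ### The stochastic representation -/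

/-- The quadratic form of the conditional covariance in the stochastic representation. -/
theorem dotProduct_self_sub_reprCoeff {k p : ℕ} (N : Matrix (Fin p) (Fin k) ℝ)
    (t : Fin k → ℝ) (v : Fin p → ℝ) :
    let P := invSqrt (N * Nᵀ) * N
    let y := CFC.sqrt (N * Nᵀ) *ᵥ v
    let b := √(t ⬝ᵥ t) • y - (reprCoeff (Pᵀ * P) t * (y ⬝ᵥ P *ᵥ t)) • (P *ᵥ t)
    b ⬝ᵥ b = (t ⬝ᵥ t) * (Nᵀ *ᵥ v ⬝ᵥ Nᵀ *ᵥ v) - (Nᵀ *ᵥ v ⬝ᵥ t) ^ 2 := by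
  intro P y b
  have hD : (N * Nᵀ).PosSemidef := by
    simpa using Matrix.posSemidef_self_mul_conjTranspose N
  have hyy : y ⬝ᵥ y = Nᵀ *ᵥ v ⬝ᵥ Nᵀ *ᵥ v := by
    rw [← dotProduct_sqrt_mulVec, mulVec_mulVec, CFC.sqrt_mul_sqrt_self _ hD.nonneg,
      ← mulVec_mulVec, dotProduct_mulVec, mulVec_transpose]
  have hyt : y ⬝ᵥ P *ᵥ t = Nᵀ *ᵥ v ⬝ᵥ t := by
    rw [← dotProduct_sqrt_mulVec, mulVec_mulVec, sqrt_mul_invSqrt_mul_eq, dotProduct_mulVec,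
      mulVec_transpose]
  have ha := Real.sq_sqrt (show 0 ≤ t ⬝ᵥ t by simpa using dotProduct_star_self_nonneg t)
  rw [← hyy, ← hyt]
  simp only [b, sub_dotProduct, dotProduct_sub, smul_dotProduct, dotProduct_smul, smul_eq_mul,
    dotProduct_comm (P *ᵥ t) y]
  -- When `P t = 0` the value of the coefficient is multiplied by zero.
  by_cases h : P *ᵥ t = 0
  · rw [h, dotProduct_zero]
    linear_combination (y ⬝ᵥ y) * ha
  · have := reprCoeff_identity P (invSqrt_mul_mul_transpose_mul_self N) t h
    linear_combination (y ⬝ᵥ y) * ha - (y ⬝ᵥ P *ᵥ t) ^ 2 * this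

theorem repr_mulVec {k p : ℕ} (R : Matrix (Fin p) (Fin p) ℝ) (P : Matrix (Fin p) (Fin k) ℝ)
    (a c : ℝ) (t : Fin k → ℝ) (z : Fin p → ℝ) :
    (R * (a • (1 : Matrix (Fin p) (Fin p) ℝ) - c • (P * vecMulVec t t * Pᵀ))) *ᵥ z =
      R *ᵥ (a • z - (c * (P *ᵥ t ⬝ᵥ z)) • (P *ᵥ t)) := by
  rw [mul_vecMulVec, vecMulVec_mul, vecMul_transpose, ← mulVec_mulVec, sub_mulVec, smul_mulVec,
    smul_mulVec, one_mulVec, vecMulVec_mulVec, op_smul_eq_smul, smul_smul]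

/-- The conditional characteristic function of the stochastic representation. -/
theorem integral_exp_repr {k p : ℕ} (n : ℕ) (N : Matrix (Fin p) (Fin k) ℝ)
    (t : Fin k → ℝ) (v : Fin p → ℝ) :
    let P := invSqrt (N * Nᵀ) * N
    ∫ x : ℝ × EuclideanSpace ℝ (Fin p), Complex.exp (((v ⬝ᵥ (x.1 • (N *ᵥ t) +
        √x.1 • (CFC.sqrt (N * Nᵀ) *ᵥ (√(t ⬝ᵥ t) • x.2.ofLp -
          (reprCoeff (Pᵀ * P) t * (P *ᵥ t ⬝ᵥ x.2.ofLp)) • (P *ᵥ t)))) : ℝ) : ℂ) * Complex.I)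
        ∂(chiSquared n).prod (stdGaussian (EuclideanSpace ℝ (Fin p))) =
      ∫ x, Complex.exp (x * (((Nᵀ *ᵥ v ⬝ᵥ t : ℝ) : ℂ) * Complex.I -
        (((t ⬝ᵥ t) * (Nᵀ *ᵥ v ⬝ᵥ Nᵀ *ᵥ v) - (Nᵀ *ᵥ v ⬝ᵥ t) ^ 2 : ℝ) : ℂ) / 2))
        ∂chiSquared n := by
  intro P
  rw [integral_prod _ (integrable_exp_ofReal_mul_I (by fun_prop))]
  refine integral_congr_ae ?_
  -- Nonnegativity is what turns `√c * √c` in the variance into `c`.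
  filter_upwards [ae_nonneg_chiSquared n] with c hc
  set y := CFC.sqrt (N * Nᵀ) *ᵥ v with hy
  set b := √(t ⬝ᵥ t) • y - (reprCoeff (Pᵀ * P) t * (y ⬝ᵥ P *ᵥ t)) • (P *ᵥ t) with hb
  have hbb : b ⬝ᵥ b = (t ⬝ᵥ t) * (Nᵀ *ᵥ v ⬝ᵥ Nᵀ *ᵥ v) - (Nᵀ *ᵥ v ⬝ᵥ t) ^ 2 :=
    dotProduct_self_sub_reprCoeff N t v
  have h (g : EuclideanSpace ℝ (Fin p)) : v ⬝ᵥ (c • (N *ᵥ t) + √c • (CFC.sqrt (N * Nᵀ) *ᵥ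
      (√(t ⬝ᵥ t) • g.ofLp - (reprCoeff (Pᵀ * P) t * (P *ᵥ t ⬝ᵥ g.ofLp)) • (P *ᵥ t)))) =
      c * (Nᵀ *ᵥ v ⬝ᵥ t) + g.ofLp ⬝ᵥ (√c • b) := by
    rw [dotProduct_add, dotProduct_smul, dotProduct_smul, dotProduct_sqrt_mulVec, ← hy,
      dotProduct_mulVec v N, ← mulVec_transpose, hb, dotProduct_smul, dotProduct_sub,
      dotProduct_sub, dotProduct_smul, dotProduct_smul, dotProduct_smul, dotProduct_smul,
      dotProduct_comm g.ofLp y, dotProduct_comm g.ofLp]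
    simp only [smul_eq_mul]
    ring
  simp only [h, Complex.ofReal_add, add_mul, Complex.exp_add]
  rw [integral_const_mul, integral_exp_dotProduct_stdGaussian, ← Complex.exp_add, ← hbb,
    smul_dotProduct, dotProduct_smul, smul_eq_mul, smul_eq_mul, ← mul_assoc,
    Real.mul_self_sqrt hc]
  congr 1
  push_cast
  ring

/-- The random vector of the stochastic representation, with `N = M S^{1/2}`, as a function of
the triple `(t, ζ, z₀)`. -/
noncomputable def reprVector {k p : ℕ} (N : Matrix (Fin p) (Fin k) ℝ)
    (x : EuclideanSpace ℝ (Fin k) × ℝ × EuclideanSpace ℝ (Fin p)) : Fin p → ℝ :=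
  x.2.1 • (N *ᵥ x.1.ofLp) + √x.2.1 • (CFC.sqrt (N * Nᵀ) *ᵥ
    (√(x.1.ofLp ⬝ᵥ x.1.ofLp) • x.2.2.ofLp -
      (reprCoeff ((invSqrt (N * Nᵀ) * N)ᵀ * (invSqrt (N * Nᵀ) * N)) x.1.ofLp *
        ((invSqrt (N * Nᵀ) * N) *ᵥ x.1.ofLp ⬝ᵥ x.2.2.ofLp)) •
          ((invSqrt (N * Nᵀ) * N) *ᵥ x.1.ofLp)))

@[fun_prop]
theorem measurable_reprVector {k p : ℕ} (N : Matrix (Fin p) (Fin k) ℝ) :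
    Measurable (reprVector N) := by
  unfold reprVector
  fun_prop

theorem map_mulVec_mulVec_eq_map_reprVector {k p : ℕ} (n : ℕ) {S : Matrix (Fin k) (Fin k) ℝ}
    (hS : S.PosSemidef) (μ : EuclideanSpace ℝ (Fin k)) {κ : ℝ} (hκ : 0 ≤ κ)
    (M : Matrix (Fin p) (Fin k) ℝ) :
    ((multivariateGaussian μ (κ • S)).prod (wishart n S)).map
        (fun x => M *ᵥ (x.2 *ᵥ x.1.ofLp)) =
      ((multivariateGaussian (WithLp.toLp 2 (CFC.sqrt S *ᵥ μ.ofLp)) (κ • S ^ 2)).prod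
        ((chiSquared n).prod (stdGaussian (EuclideanSpace ℝ (Fin p))))).map
          (reprVector (M * CFC.sqrt S)) := by
  have hF : Measurable fun x : EuclideanSpace ℝ (Fin k) × Matrix (Fin k) (Fin k) ℝ =>
    M *ᵥ (x.2 *ᵥ x.1.ofLp) := by fun_prop
  have hG := measurable_reprVector (M * CFC.sqrt S)
  have := Measure.isProbabilityMeasure_map
    (μ := (multivariateGaussian μ (κ • S)).prod (wishart n S)) hF.aemeasurable
  have := Measure.isProbabilityMeasure_map
    (μ := (multivariateGaussian (WithLp.toLp 2 (CFC.sqrt S *ᵥ μ.ofLp)) (κ • S ^ 2)).prod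
      ((chiSquared n).prod (stdGaussian (EuclideanSpace ℝ (Fin p))))) hG.aemeasurable
  refine Measure.ext_of_charFunDual ?_
  ext L
  have ⟨v, hL⟩ : ∃ v : Fin p → ℝ, ∀ x, L x = v ⬝ᵥ x := ⟨fun i => L (Pi.single i 1), fun x => by
    conv_lhs => rw [pi_eq_sum_univ' x]
    simp [dotProduct, mul_comm]⟩
  rw [charFunDual_apply, charFunDual_apply,
    integral_map hF.aemeasurable (Measurable.aestronglyMeasurable (by fun_prop)),
    integral_map hG.aemeasurable (Measurable.aestronglyMeasurable (by fun_prop))]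
  simp only [hL]
  -- Writing the law of `t` as that of `S^{1/2} z` makes both outer integrals run over `z`, so the
  -- conditional characteristic functions can be compared pointwise.
  rw [integral_prod _ (integrable_exp_ofReal_mul_I (by fun_prop)),
    integral_prod _ (integrable_exp_ofReal_mul_I (by fun_prop)),
    ← multivariateGaussian_map_sqrt hS μ hκ,
    integral_map (Measurable.aemeasurable (by fun_prop))]
  · refine integral_congr_ae (.of_forall fun x => ?_)
    have hw : CFC.sqrt S *ᵥ (Mᵀ *ᵥ v) = (M * CFC.sqrt S)ᵀ *ᵥ v := by
      rw [transpose_mul, transpose_sqrt, mulVec_mulVec]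
    simp only [dotProduct_mulVec v M, ← mulVec_transpose M]
    rw [integral_exp_dotProduct_mulVec_wishart, hw]
    exact (integral_exp_repr n (M * CFC.sqrt S) (CFC.sqrt S *ᵥ x.ofLp) v).symm
  · have h : StronglyMeasurable fun x => Complex.exp
        (((v ⬝ᵥ reprVector (M * CFC.sqrt S) x : ℝ) : ℂ) * Complex.I) :=
      Measurable.stronglyMeasurable (by fun_prop)
    exact h.integral_prod_right'.aestronglyMeasurable

theorem mainTheorem1 {k n p r : ℕ}
    {Ω : Type*} [MeasurableSpace Ω] (Pr : Measure Ω) [IsProbabilityMeasure Pr]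
    {Ω' : Type*} [MeasurableSpace Ω'] (Pr' : Measure Ω') [IsProbabilityMeasure Pr']
    (S : Matrix (Fin k) (Fin k) ℝ) (hS : S.PosSemidef) (hSr : S.rank = r) (hrk : r < k)
    (μ : EuclideanSpace ℝ (Fin k)) (κ : ℝ) (hκ : 0 < κ)
    (M : Matrix (Fin p) (Fin k) ℝ) (hM : M.rank = p) (hpr : p < r) (hrn : r ≤ n)
    (P : Matrix (Fin p) (Fin k) ℝ) (hP : P = invSqrt (M * S * Mᵀ) * M * CFC.sqrt S)
    (Q : Matrix (Fin k) (Fin k) ℝ) (hQ : Q = Pᵀ * P)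
    -- the Wishart matrix and the Gaussian vector
    (A : Ω → Matrix (Fin k) (Fin k) ℝ) (hA : HasLaw A (wishart n S) Pr)
    (z : Ω → EuclideanSpace ℝ (Fin k)) (hz : HasLaw z (multivariateGaussian μ (κ • S)) Pr)
    (hAz : IndepFun A z Pr)
    -- the variables of the stochastic representation, on any probability space
    (ζ : Ω' → ℝ) (hζ : HasLaw ζ (chiSquared n) Pr')
    (t : Ω' → EuclideanSpace ℝ (Fin k))
    (ht : HasLaw t
      (multivariateGaussian (WithLp.toLp 2 (CFC.sqrt S *ᵥ μ.ofLp)) (κ • S ^ 2)) Pr')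
    (z₀ : Ω' → EuclideanSpace ℝ (Fin p))
    (hz₀ : HasLaw z₀ (multivariateGaussian 0 (1 : Matrix (Fin p) (Fin p) ℝ)) Pr')
    -- mutual independence of the three variables
    (hind : iIndep ![MeasurableSpace.comap ζ inferInstance, MeasurableSpace.comap t inferInstance,
      MeasurableSpace.comap z₀ inferInstance] Pr') :
    IdentDistrib
      (fun ω => M *ᵥ (A ω *ᵥ (z ω).ofLp))
      (fun ω => ζ ω • ((M * CFC.sqrt S) *ᵥ (t ω).ofLp) +
        √(ζ ω) • ((CFC.sqrt (M * S * Mᵀ) *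
          (√((t ω).ofLp ⬝ᵥ (t ω).ofLp) • (1 : Matrix (Fin p) (Fin p) ℝ) -
            reprCoeff Q (t ω).ofLp •
              (P * vecMulVec (t ω).ofLp (t ω).ofLp * Pᵀ))) *ᵥ (z₀ ω).ofLp))
      Pr Pr' := by
  -- With `N = M * CFC.sqrt S`, everything is expressed through `N` and `N Nᵀ`.
  have hD : M * S * Mᵀ = M * CFC.sqrt S * (M * CFC.sqrt S)ᵀ := by
    rw [transpose_mul, transpose_sqrt, Matrix.mul_assoc, Matrix.mul_assoc,
      ← Matrix.mul_assoc (CFC.sqrt S), CFC.sqrt_mul_sqrt_self S hS.nonneg]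
  rw [Matrix.mul_assoc, hD] at hP
  rw [hD]
  simp only [repr_mulVec]
  rw [multivariateGaussian_zero_one] at hz₀
  have hl := hAz.symm.hasLaw_prod hz hA
  have hr := hasLaw_prodMk_of_iIndep hζ ht hz₀ hind
  have hF : Measurable fun x : EuclideanSpace ℝ (Fin k) × Matrix (Fin k) (Fin k) ℝ =>
    M *ᵥ (x.2 *ᵥ x.1.ofLp) := by fun_prop
  have hG := measurable_reprVector (M * CFC.sqrt S)
  subst hQ hP
  have h : IdentDistrib
      ((fun x : EuclideanSpace ℝ (Fin k) × Matrix (Fin k) (Fin k) ℝ => M *ᵥ (x.2 *ᵥ x.1.ofLp)) ∘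
        fun ω => (z ω, A ω))
      (reprVector (M * CFC.sqrt S) ∘ fun ω => (t ω, ζ ω, z₀ ω)) Pr Pr' := by
    refine ⟨hF.comp_aemeasurable hl.aemeasurable, hG.comp_aemeasurable hr.aemeasurable, ?_⟩
    rw [← AEMeasurable.map_map_of_aemeasurable hF.aemeasurable hl.aemeasurable,
      ← AEMeasurable.map_map_of_aemeasurable hG.aemeasurable hr.aemeasurable, hl.map_eq, hr.map_eq,
      map_mulVec_mulVec_eq_map_reprVector n hS μ hκ.le M]
  simpa only [reprVector, Function.comp_def] using h
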